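/- **Definitions.** Let $X$ be a complex Banach space with dual $X^*$. A Rademacher variable takes the values $1$ and $-1$ with probability $1/2$ each; a Steinhaus variable is uniformly distributed on $\{z\in\mathbb{C}:|z|=1\}$; a standard complex Gaussian variable has independent centred real Gaussian real and imaginary parts of variance $1/2$. For a bounded operator $S:E\to F$ between complex normed spaces, the $1$-summing norm $\pi_1(S)\in[0,\infty]$ is the least $C\ge 0$ such that for every finite choice $y_1,\dots,y_N\in E$ $$\sum_{k=1}^N\|S y_k\|\le C\,\sup_{\varphi\in E^*,\,\|\varphi\|\le 1}\ \sum_{k=1}^N|\varphi(y_k)|$$ (and $\infty$ if there is none). $X$ has the *Gaussian Average Property (GAP)* if there is $C\ge 1$ such that for every finite choice $x_1,\dots,x_n\in X$ the operator $T:\ell_2^n\to X$ defined by $T(e_i)=x_i$ satisfies $$\Big(\mathbb{E}\Big\|\sum_{i=1}^n \gamma_i x_i\Big\|^2\Big)^{1/2}\le C\,\pi_1(T^*),$$ where $\gamma_1,\dots,\gamma_n$ are independent standard complex Gaussian variables and $T^*:X^*\to(\ell_2^n)^*$ is the adjoint operator. **Theorem.** Let $X$ be a complex Banach space with GAP. There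 is a constant $C\ge 1$, depending only on $X$, such that for all $n,m\in\mathbb{N}_0$ and every family of vectors $\{x_\alpha\}$ in $X$ indexed by the multi-indices $\alpha=(\alpha_1,\dots,\alpha_n)\in\mathbb{N}_0^n$ with $|\alpha|=\alpha_1+\cdots+\alpha_n\le m$, $$\Big(\mathbb{E}\Big\|\sum_{|\alpha|\le m}\varepsilon_{i_\alpha}x_\alpha\Big\|^2\Big)^{1/2}\le C\;\mathbb{E}\Big\|\sum_{|\alpha|\le m}\sqrt{2}^{\,|\alpha|}\,x_\alpha w^\alpha\Big\|,$$ where $(\varepsilon_{i_\alpha})_{|\alpha|\le m}$ are independent Rademacher variables, one for each multi-index, $w=(w_1,\dots,w_n)$ is a vector of independent Steinhaus variables, and $w^\alpha=w_1^{\alpha_1}\cdots w_n^{\alpha_n}$. -/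

import Mathlib

open MeasureTheory ProbabilityTheory
open scoped NNReal ENNReal

noncomputable section

namespace GaussianAverage

/-- Law of a Rademacher variable: the values `1` and `-1` with probability `1/2` each. -/
def rademacherLaw : Measure ℝ :=
  (2⁻¹ : ℝ≥0∞) • Measure.dirac 1 + (2⁻¹ : ℝ≥0∞) • Measure.dirac (-1)

/-- Law of a Steinhaus variable: the uniform distribution on the unit circle of `ℂ`. -/
def steinhausLaw : Measure ℂ :=
  (volume.restrict (Set.Ioc (0 : ℝ) 1)).map fun t : ℝ => Complex.exp (2 * Real.pi * t * Complex.I)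

/-- Law of a standard complex Gaussian variable `γ`: the real and the imaginary part are
independent, centred, real Gaussian with variance `1/2`, so that `𝔼|γ|² = 1`. -/
def complexGaussianLaw : Measure ℂ :=
  ((gaussianReal 0 (1 / 2)).prod (gaussianReal 0 (1 / 2))).map
    fun p => (p.1 : ℂ) + (p.2 : ℂ) * Complex.I

section Summing

variable {E F : Type*} [NormedAddCommGroup E] [NormedSpace ℂ E]
  [NormedAddCommGroup F] [NormedSpace ℂ F]

/-- The weak `ℓ₁`-norm `sup_{‖φ‖ ≤ 1} ∑ₖ |φ(yₖ)|` of a finite family of vectors, where `φ` runs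
over the closed unit ball of the dual space. The supremum is over a nonempty set which is bounded
by `∑ₖ ‖yₖ‖`. -/
def weakOneNorm {N : ℕ} (y : Fin N → E) : ℝ :=
  ⨆ φ : Metric.closedBall (0 : StrongDual ℂ E) 1, ∑ k, ‖(φ : StrongDual ℂ E) (y k)‖

/-- `C` is an admissible constant in the definition of a `1`-summing operator, for `S`. -/
def IsOneSummingWith (S : E →L[ℂ] F) (C : ℝ≥0) : Prop :=
  ∀ (N : ℕ) (y : Fin N → E), ∑ k, ‖S (y k)‖ ≤ C * weakOneNorm y

/-- The `1`-summing norm `π₁(S)`, the least admissible constant (and `∞` if there is none). -/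
def oneSummingNorm (S : E →L[ℂ] F) : ℝ≥0∞ :=
  ⨅ (C : ℝ≥0) (_ : IsOneSummingWith S C), (C : ℝ≥0∞)

end Summing

section GAP

variable {X : Type*} [NormedAddCommGroup X] [NormedSpace ℂ X]

/-- The operator `T : ℓ₂ⁿ → X` with `T eᵢ = xᵢ`. -/
def operatorOf {n : ℕ} (x : Fin n → X) : EuclideanSpace ℂ (Fin n) →L[ℂ] X :=
  ∑ i, (EuclideanSpace.proj (𝕜 := ℂ) i : EuclideanSpace ℂ (Fin n) →L[ℂ] ℂ).smulRight (x i)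

theorem operatorOf_single {n : ℕ} (x : Fin n → X) (j : Fin n) :
    operatorOf x (EuclideanSpace.single j 1) = x j := by
  simp [operatorOf]

/-- The Banach space adjoint `T* : X* → (ℓ₂ⁿ)*`, `T* φ = φ ∘ T`. -/
def dualOperator {n : ℕ} (T : EuclideanSpace ℂ (Fin n) →L[ℂ] X) :
    StrongDual ℂ X →L[ℂ] StrongDual ℂ (EuclideanSpace ℂ (Fin n)) :=
  ContinuousLinearMap.precomp ℂ T

variable (X) in
/-- The Gaussian Average Property: `(𝔼‖∑ᵢ γᵢ xᵢ‖²)^{1/2} ≤ C π₁(T*)` for all finite families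
`x₁, …, xₙ` in `X`, where `T : ℓ₂ⁿ → X`, `T eᵢ = xᵢ`, and `γ₁, …, γₙ` are independent standard
complex Gaussian variables. -/
def HasGAP : Prop :=
  ∃ C : ℝ≥0, 1 ≤ C ∧ ∀ (n : ℕ) (x : Fin n → X),
    eLpNorm (fun z : Fin n → ℂ => ∑ i, z i • x i) 2 (Measure.pi fun _ => complexGaussianLaw)
      ≤ C * oneSummingNorm (dualOperator (operatorOf x))

end GAP

/-- The multi-indices `α ∈ ℕ₀ⁿ` with `|α| = α₁ + ⋯ + αₙ ≤ m`. -/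
abbrev MultiIndex (n m : ℕ) : Type := {α : Fin n → ℕ // ∑ i, α i ≤ m}

instance instFintypeMultiIndex (n m : ℕ) : Fintype (MultiIndex n m) :=
  Fintype.subtype
    ((Fintype.piFinset fun _ : Fin n => Finset.range (m + 1)).filter fun α => ∑ i, α i ≤ m)
    (fun α => by
      simp only [Finset.mem_filter, Fintype.mem_piFinset, Finset.mem_range, and_iff_right_iff_imp]
      intro h i
      have := Finset.single_le_sum (f := α) (fun j _ => Nat.zero_le (α j)) (Finset.mem_univ i)
      omega)

/-- The degree `|α|`. -/
def MultiIndex.degree {n m : ℕ} (α : MultiIndex n m) : ℕ := ∑ i, α.1 i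

end GaussianAverage

end

noncomputable section

namespace GaussianAverage

open Metric

/-! Write f = ∑ √2^|α| x_α w^α. The scalar core is hypercontractivity, (∑ |c_β|² / 2^|β|)^{1/2} ≤
𝔼|∑ c_β w^β| (`sqrt_sum_sq_coeff_le`). Applied to φ(f), it makes the powers of √2 cancel: (∑
|φ(x_α)|²)^{1/2} ≤ 𝔼|φ(f)| for every functional φ. The left side dominates ‖T*φ‖, so summing over
finitely many φₖ inside the expectation gives π₁(T*) ≤ 𝔼‖f‖ (`oneSummingNorm_dualOperator_le`). GAP
turns this into a bound for the Gaussian average of the x_α, which dominates their Rademacher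
average up to an absolute constant (`absMoment_sq_mul_lintegral_le`).

In one variable, hypercontractivity comes from a factorization p = uv in the disc algebra with |u|²
= |v|² = |p| on the circle, so that ‖u‖₂² = ‖v‖₂² = ‖p‖₁. The k-th coefficient of p is a Cauchy
product of k + 1 terms, and Cauchy–Schwarz costs the factor k + 1 ≤ 2^k. Minkowski's inequality
carries the estimate to several variables, one variable at a time. -/

/-! ### Taylor and Fourier coefficients in the disc algebra. -/

/-- The parametrization `t ↦ exp (2πit)` of the unit circle. -/
def circlePoint (t : ℝ) : ℂ := Complex.exp (2 * Real.pi * t * Complex.I)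

@[fun_prop]
lemma continuous_circlePoint : Continuous circlePoint := by
  unfold circlePoint; fun_prop

@[simp]
lemma norm_circlePoint (t : ℝ) : ‖circlePoint t‖ = 1 := by
  have : (2 * Real.pi * t * Complex.I : ℂ) = ((2 * Real.pi * t : ℝ) : ℂ) * Complex.I := by
    push_cast; ring
  rw [circlePoint, this, Complex.norm_exp_ofReal_mul_I]

lemma circlePoint_eq_circleMap (t : ℝ) : circlePoint t = circleMap 0 1 (2 * Real.pi * t) := by
  simp [circlePoint, circleMap]

lemma continuous_comp_circlePoint {E : Type*} [TopologicalSpace E] {u : ℂ → E}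
    (hu : ContinuousOn u (closedBall 0 1)) : Continuous fun t => u (circlePoint t) :=
  hu.comp_continuous continuous_circlePoint (by simp)

/-- Cauchy's integral formula on the unit circle itself, which is available for functions merely
continuous up to the boundary, rewritten with θ = 2πt. -/
lemma fourierCoeffOn_circlePoint {u : ℂ → ℂ} (hu : DiffContOnCl ℂ u (ball 0 1)) (k : ℕ) :
    fourierCoeffOn zero_lt_one (fun t => u (circlePoint t)) k
      = iteratedDeriv k u 0 / k.factorial := by
  have h := hu.circleIntegral_one_div_sub_center_pow_smul zero_lt_one k
  rw [fourierCoeffOn_eq_integral]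
  have h2 : ∮ z in C(0, 1), (1 / (z - 0) ^ (k + 1)) • u z
      = (2 * Real.pi * Complex.I) *
        ∫ t in (0:ℝ)..1, circlePoint t ^ (-(k : ℤ)) * u (circlePoint t) := by
    rw [circleIntegral]
    have := intervalIntegral.smul_integral_comp_mul_left (a := 0) (b := 1)
      (fun θ => deriv (circleMap 0 1) θ • ((1 / (circleMap 0 1 θ - 0) ^ (k + 1)) •
        u (circleMap 0 1 θ))) (2 * Real.pi)
    rw [mul_zero, mul_one] at this
    rw [← this, Complex.real_smul, ← intervalIntegral.integral_const_mul,
      ← intervalIntegral.integral_const_mul]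
    refine intervalIntegral.integral_congr fun t _ => ?_
    have hne : circlePoint t ≠ 0 := by
      rw [← norm_ne_zero_iff]; simp
    simp only [deriv_circleMap, smul_eq_mul, sub_zero, ← circlePoint_eq_circleMap, zpow_neg,
      zpow_natCast]
    push_cast
    field_simp
    ring
  rw [h2] at h
  have h3 : ∫ t in (0:ℝ)..1, circlePoint t ^ (-(k : ℤ)) * u (circlePoint t)
      = iteratedDeriv k u 0 / k.factorial := by
    have : (2 * Real.pi * Complex.I : ℂ) ≠ 0 := Complex.two_pi_I_ne_zero
    apply mul_left_cancel₀ this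
    rw [h, smul_eq_mul]; ring
  rw [← h3]
  simp only [sub_zero, div_one, one_smul]
  refine intervalIntegral.integral_congr fun t _ => ?_
  simp only [smul_eq_mul]
  congr 1
  rw [fourier_coe_apply, circlePoint, ← Complex.exp_int_mul]
  congr 1
  push_cast
  simp
  ring

/-- Parseval on the circle, keeping only the frequencies 0, …, N - 1. -/
lemma sum_sq_taylorCoeff_le {u : ℂ → ℂ} (hu : DiffContOnCl ℂ u (ball 0 1)) (N : ℕ) :
    ∑ k ∈ Finset.range N, ‖iteratedDeriv k u 0 / k.factorial‖ ^ 2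
      ≤ ∫ t in (0:ℝ)..1, ‖u (circlePoint t)‖ ^ 2 := by
  have hc : Continuous fun t => u (circlePoint t) := by
    apply continuous_comp_circlePoint
    simpa [closure_ball (0:ℂ) one_ne_zero] using hu.2
  have hL : MemLp (fun t => u (circlePoint t)) 2 (volume.restrict (Set.Ioc (0:ℝ) 1)) := by
    obtain ⟨C, hC⟩ := isCompact_Icc.exists_bound_of_continuousOn (s := Set.Icc (0:ℝ) 1)
      hc.continuousOn
    refine MemLp.of_bound hc.aestronglyMeasurable C ?_
    filter_upwards [ae_restrict_mem measurableSet_Ioc] with t ht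
    exact hC t (Set.Ioc_subset_Icc_self ht)
  have h := hasSum_sq_fourierCoeffOn zero_lt_one hL
  rw [sub_zero, inv_one, one_smul] at h
  refine le_trans (le_of_eq ?_) (sum_le_hasSum ((Finset.range N).map Nat.castEmbedding)
    (fun _ _ => by positivity) h)
  rw [Finset.sum_map]
  refine Finset.sum_congr rfl fun k _ => ?_
  rw [← fourierCoeffOn_circlePoint hu]; rfl

/-! ### Balanced factorization of polynomials. -/

/-- `f = u v` on the closed disc for functions `u`, `v` of the disc algebra which have the same
modulus on the unit circle. -/
def HasBalancedFactorization (f : ℂ → ℂ) : Prop :=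
  ∃ u v : ℂ → ℂ, DiffContOnCl ℂ u (ball 0 1) ∧ DiffContOnCl ℂ v (ball 0 1) ∧
    (∀ z ∈ closedBall (0 : ℂ) 1, f z = u z * v z) ∧
    ∀ z ∈ sphere (0 : ℂ) 1, ‖u z‖ = ‖v z‖

lemma HasBalancedFactorization.mul {f g : ℂ → ℂ} (hf : HasBalancedFactorization f)
    (hg : HasBalancedFactorization g) : HasBalancedFactorization fun z => f z * g z := by
  obtain ⟨u, v, hu, hv, h, h'⟩ := hf
  obtain ⟨u', v', hu', hv', k, k'⟩ := hg
  refine ⟨fun z => u z * u' z, fun z => v z * v' z, hu.smul hu', hv.smul hv', fun z hz => ?_,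
    fun z hz => ?_⟩
  · simp only [h z hz, k z hz]; ring
  · simp only [norm_mul, h' z hz, k' z hz]

lemma hasBalancedFactorization_const (a : ℂ) : HasBalancedFactorization fun _ => a := by
  obtain ⟨s, hs⟩ := IsAlgClosed.exists_pow_nat_eq a (n := 2) (by norm_num)
  exact ⟨fun _ => s, fun _ => s, diffContOnCl_const, diffContOnCl_const,
    fun _ _ => by rw [← hs, sq], fun _ _ => rfl⟩

/-- On the closed disc `1 - a * z` has nonnegative real part, so the principal root applies. It may
vanish on the circle when ‖a‖ = 1; there the root is still continuous, though not differentiable. -/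
lemma diffContOnCl_sqrt_one_sub_mul {a : ℂ} (ha : ‖a‖ ≤ 1) :
    DiffContOnCl ℂ (fun z => (1 - a * z) ^ (1 / 2 : ℂ)) (ball 0 1) := by
  have hle : ∀ z : ℂ, ‖z‖ ≤ 1 → ‖a * z‖ ≤ 1 := fun z hz => by
    rw [norm_mul]; exact mul_le_one₀ ha (norm_nonneg _) hz
  constructor
  · intro z hz
    have hz' : ‖a * z‖ < 1 := by
      rw [norm_mul]
      have : ‖z‖ < 1 := by simpa using hz
      nlinarith [norm_nonneg a, norm_nonneg z]
    apply DifferentiableAt.differentiableWithinAt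
    refine DifferentiableAt.cpow_const (by fun_prop) ?_
    left
    have := (Complex.abs_re_le_norm (a * z)).trans_lt hz'
    rw [Complex.sub_re, Complex.one_re]
    linarith [le_abs_self (a * z).re]
  · rw [closure_ball (0:ℂ) one_ne_zero]
    intro z hz
    have h1 := hle z (by simpa using hz)
    have h2 : 0 ≤ (1 - a * z).re := by
      rw [Complex.sub_re, Complex.one_re]
      linarith [le_abs_self (a * z).re, Complex.abs_re_le_norm (a * z)]
    apply ContinuousAt.continuousWithinAt
    exact ContinuousAt.comp (f := fun z => 1 - a * z) (g := fun w : ℂ => w ^ (1 / 2 : ℂ))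
      (Complex.continuousAt_cpow_const_of_re_pos (Or.inl h2) (by norm_num))
      (by fun_prop)

lemma cpow_half_mul_self (z : ℂ) : z ^ (1 / 2 : ℂ) * z ^ (1 / 2 : ℂ) = z := by
  rw [← sq]
  simp

lemma norm_sub_eq_norm_one_sub_conj_mul (b : ℂ) {z : ℂ} (hz : ‖z‖ = 1) :
    ‖z - b‖ = ‖1 - (starRingEnd ℂ) b * z‖ := by
  have h : z * (starRingEnd ℂ) z = 1 := by rw [Complex.mul_conj']; simp [hz]
  calc ‖z - b‖ = ‖(starRingEnd ℂ) (z - b)‖ * ‖z‖ := by rw [RCLike.norm_conj, hz, mul_one]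
    _ = ‖1 - (starRingEnd ℂ) b * z‖ := by
      rw [← norm_mul, map_sub, sub_mul, mul_comm _ z, h]

/-- For a root b inside the disc, v = (1 - b̄z)^{1/2} has no zero and u = (z - b)/v; they balance
because |z - b| = |1 - b̄z| on the circle. For |b| ≥ 1, z - b = -b(1 - z/b), and the second factor
has a square root in the disc algebra. -/
lemma hasBalancedFactorization_sub (b : ℂ) : HasBalancedFactorization fun z => z - b := by
  rcases lt_or_ge ‖b‖ 1 with hb | hb
  · have hv := diffContOnCl_sqrt_one_sub_mul (a := (starRingEnd ℂ) b) (by simpa using hb.le)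
    have hne : ∀ z ∈ closedBall (0 : ℂ) 1, (1 - (starRingEnd ℂ) b * z) ^ (1 / 2 : ℂ) ≠ 0 := by
      intro z hz h0
      have h1 : 1 - (starRingEnd ℂ) b * z = 0 := by
        rw [← cpow_half_mul_self (1 - _), h0, mul_zero]
      have h2 : ‖(starRingEnd ℂ) b * z‖ = 1 := by rw [← sub_eq_zero.1 h1, norm_one]
      rw [norm_mul, RCLike.norm_conj] at h2
      have : ‖z‖ ≤ 1 := by simpa using hz
      nlinarith [norm_nonneg b, norm_nonneg z]
    have hinv := hv.inv (by simpa [closure_ball (0:ℂ) one_ne_zero] using hne)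
    have hid : DiffContOnCl ℂ (fun z : ℂ => z - b) (ball 0 1) :=
      (differentiable_id.sub_const b).diffContOnCl
    refine ⟨_, _, hid.smul hinv, hv, fun z hz => ?_, fun z hz => ?_⟩
    · simp only [smul_eq_mul, Pi.inv_apply]
      rw [mul_assoc, inv_mul_cancel₀ (hne z hz), mul_one]
    · have hz' := hne z (sphere_subset_closedBall hz)
      simp only [smul_eq_mul, Pi.inv_apply, norm_mul, norm_inv]
      rw [← div_eq_mul_inv, div_eq_iff (norm_ne_zero_iff.2 hz'), ← norm_mul, cpow_half_mul_self,
        norm_sub_eq_norm_one_sub_conj_mul b (by simpa using hz)]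
  · have hb0 : b ≠ 0 := by
      rw [← norm_pos_iff]; linarith
    have hv := diffContOnCl_sqrt_one_sub_mul (a := b⁻¹) (by
      rw [norm_inv]; exact inv_le_one_of_one_le₀ hb)
    have h : HasBalancedFactorization fun z => 1 - b⁻¹ * z :=
      ⟨_, _, hv, hv, fun z _ => (cpow_half_mul_self _).symm, fun _ _ => rfl⟩
    convert (hasBalancedFactorization_const (-b)).mul h using 2 with z
    field_simp
    ring

lemma hasBalancedFactorization_eval (p : Polynomial ℂ) :
    HasBalancedFactorization fun z => p.eval z := by
  have hp := (IsAlgClosed.splits p).eq_prod_roots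
  have key : ∀ s : Multiset ℂ,
      HasBalancedFactorization fun z => (s.map fun b => z - b).prod := by
    intro s
    induction s using Multiset.induction_on with
    | empty => simpa using hasBalancedFactorization_const 1
    | cons b s ih => simpa using (hasBalancedFactorization_sub b).mul ih
  convert (hasBalancedFactorization_const p.leadingCoeff).mul (key p.roots) using 2 with z
  conv_lhs => rw [hp]
  simp [Polynomial.eval_multiset_prod, Multiset.map_map]

/-! ### Weissler's inequality in one variable. -/

lemma iteratedDeriv_eval_div_factorial (p : Polynomial ℂ) (k : ℕ) :
    iteratedDeriv k (fun z => p.eval z) 0 / k.factorial = p.coeff k := by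
  have h : ∀ (k : ℕ) (p : Polynomial ℂ),
      iteratedDeriv k (fun z => p.eval z) = fun z => (Polynomial.derivative^[k] p).eval z := by
    intro k
    induction k with
    | zero => intro p; simp
    | succ k ih =>
      intro p
      rw [iteratedDeriv_succ', Function.iterate_succ_apply, ← ih]
      congr 1
      ext z
      exact p.deriv
  rw [h]
  simp only
  rw [← Polynomial.coeff_zero_eq_eval_zero, Polynomial.coeff_iterate_derivative, zero_add,
    Nat.descFactorial_self, nsmul_eq_mul]
  have : (k.factorial : ℂ) ≠ 0 := by exact_mod_cast k.factorial_ne_zero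
  field_simp

/-- The Taylor coefficients of a product form the Cauchy product. -/
lemma iteratedDeriv_mul_div_factorial {u v : ℂ → ℂ} (hu : AnalyticAt ℂ u 0)
    (hv : AnalyticAt ℂ v 0) (k : ℕ) :
    iteratedDeriv k (fun z => u z * v z) 0 / k.factorial
      = ∑ i ∈ Finset.range (k + 1), iteratedDeriv i u 0 / i.factorial *
        (iteratedDeriv (k - i) v 0 / (k - i).factorial) := by
  rw [iteratedDeriv_fun_mul hu.contDiffAt hv.contDiffAt, Finset.sum_div]
  refine Finset.sum_congr rfl fun i hi => ?_
  have hik : i ≤ k := by simpa [Nat.lt_succ_iff] using hi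
  have h := Nat.choose_mul_factorial_mul_factorial hik
  have hc : (k.choose i * i.factorial * (k - i).factorial : ℂ) = k.factorial := by
    exact_mod_cast h
  have h1 : (i.factorial : ℂ) ≠ 0 := by exact_mod_cast i.factorial_ne_zero
  have h2 : ((k - i).factorial : ℂ) ≠ 0 := by exact_mod_cast (k - i).factorial_ne_zero
  have h3 : (k.choose i : ℂ) ≠ 0 := by exact_mod_cast (Nat.choose_pos hik).ne'
  rw [← hc]
  field_simp

/-- If `c` is the Cauchy product of `a` and `b`, then `∑ |cₖ|² / 2ᵏ ≤ ∑ |aᵢ|² ∑ |bⱼ|²`. -/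
lemma sum_sq_cauchyProduct_le (a b : ℕ → ℂ) (N : ℕ) :
    ∑ k ∈ Finset.range N,
      ‖∑ i ∈ Finset.range (k + 1), a i * b (k - i)‖ ^ 2 / 2 ^ k
      ≤ (∑ i ∈ Finset.range N, ‖a i‖ ^ 2) * ∑ j ∈ Finset.range N, ‖b j‖ ^ 2 := by
  have h1 : ∀ k, ‖∑ i ∈ Finset.range (k + 1), a i * b (k - i)‖ ^ 2 / 2 ^ k
      ≤ ∑ i ∈ Finset.range (k + 1), ‖a i‖ ^ 2 * ‖b (k - i)‖ ^ 2 := by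
    intro k
    rw [div_le_iff₀ (by positivity)]
    -- This is where the dilation by 1/√2 is used: its squared weight 2^{-k} pays for the k + 1
    -- terms in Cauchy–Schwarz.
    have hk : ((k + 1 : ℕ) : ℝ) ≤ 2 ^ k := by exact_mod_cast Nat.lt_two_pow_self
    calc ‖∑ i ∈ Finset.range (k + 1), a i * b (k - i)‖ ^ 2
        ≤ (∑ i ∈ Finset.range (k + 1), ‖a i * b (k - i)‖) ^ 2 := by
          gcongr; exact norm_sum_le _ _
      _ ≤ (Finset.range (k + 1)).card * ∑ i ∈ Finset.range (k + 1), ‖a i * b (k - i)‖ ^ 2 :=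
          sq_sum_le_card_mul_sum_sq
      _ ≤ 2 ^ k * ∑ i ∈ Finset.range (k + 1), ‖a i * b (k - i)‖ ^ 2 := by
          rw [Finset.card_range]; gcongr
      _ = _ := by simp only [norm_mul, mul_pow, mul_comm]
  refine (Finset.sum_le_sum fun k _ => h1 k).trans ?_
  -- The map (k, i) ↦ (i, k - i) embeds the triangle i ≤ k < N into the square [0, N)², and the
  -- remaining terms are nonnegative.
  rw [Finset.sum_mul_sum, ← Finset.sum_product', Finset.sum_sigma']
  have hinj : Set.InjOn (fun x : (_ : ℕ) × ℕ => (x.2, x.1 - x.2))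
      ((Finset.range N).sigma fun k => Finset.range (k + 1)) := by
    rintro ⟨k, i⟩ hx ⟨k', i'⟩ hy h
    simp only [Finset.coe_sigma, Set.mem_sigma_iff, Finset.mem_coe, Finset.mem_range,
      Prod.mk.injEq] at hx hy h
    obtain ⟨rfl, h⟩ := h
    obtain rfl : k = k' := by omega
    rfl
  rw [← Finset.sum_image (f := fun y : ℕ × ℕ => ‖a y.1‖ ^ 2 * ‖b y.2‖ ^ 2) hinj]
  refine Finset.sum_le_sum_of_subset_of_nonneg ?_ fun _ _ _ => by positivity
  intro y hy
  simp only [Finset.mem_image, Finset.mem_sigma, Finset.mem_range] at hy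
  obtain ⟨⟨k, i⟩, hx, rfl⟩ := hy
  simp only [Finset.mem_product, Finset.mem_range]
  simp only at hx
  omega

/-- **Weissler's inequality** for polynomials in one variable: the dilation by `1/√2` maps `L¹`
contractively into `L²`. -/
theorem sum_sq_coeff_div_two_pow_le (c : ℕ → ℂ) (N : ℕ) :
    ∑ k ∈ Finset.range N, ‖c k‖ ^ 2 / 2 ^ k
      ≤ (∫ t in (0:ℝ)..1, ‖∑ k ∈ Finset.range N, c k * circlePoint t ^ k‖) ^ 2 := by
  set p : Polynomial ℂ := ∑ k ∈ Finset.range N, Polynomial.C (c k) * Polynomial.X ^ k with hp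
  have hcoeff : ∀ k ∈ Finset.range N, p.coeff k = c k := by
    intro k hk
    simp only [hp, Polynomial.finsetSum_coeff, Polynomial.coeff_C_mul_X_pow]
    simp [Finset.sum_ite_eq, Finset.mem_range.1 hk]
  have heval : ∀ z, p.eval z = ∑ k ∈ Finset.range N, c k * z ^ k := by
    intro z; simp [hp, Polynomial.eval_finsetSum]
  obtain ⟨u, v, hu, hv, huv, hnorm⟩ := hasBalancedFactorization_eval p
  simp only at huv
  have han : ∀ {u : ℂ → ℂ}, DiffContOnCl ℂ u (ball 0 1) → AnalyticAt ℂ u 0 := fun h =>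
    h.differentiableOn.analyticAt (ball_mem_nhds 0 one_pos)
  have hck : ∀ k ∈ Finset.range N, c k = ∑ i ∈ Finset.range (k + 1),
      iteratedDeriv i u 0 / i.factorial * (iteratedDeriv (k - i) v 0 / (k - i).factorial) := by
    intro k hk
    rw [← iteratedDeriv_mul_div_factorial (han hu) (han hv), ← hcoeff k hk,
      ← iteratedDeriv_eval_div_factorial]
    congr 1
    -- The factorization is known only on the closed disc, but derivatives at 0 depend only on the
    -- germ there.
    refine Filter.EventuallyEq.iteratedDeriv_eq k ?_
    filter_upwards [closedBall_mem_nhds (0:ℂ) one_pos] with z hz using huv z hz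
  have hmem : ∀ t, circlePoint t ∈ sphere (0:ℂ) 1 := by simp
  have hint : ∀ {w : ℂ → ℂ}, (∀ z ∈ sphere (0:ℂ) 1, ‖w z‖ ^ 2 = ‖p.eval z‖) →
      ∫ t in (0:ℝ)..1, ‖w (circlePoint t)‖ ^ 2
      = ∫ t in (0:ℝ)..1, ‖∑ k ∈ Finset.range N, c k * circlePoint t ^ k‖ := by
    intro w hw
    refine intervalIntegral.integral_congr fun t _ => ?_
    simp only [hw _ (hmem t), heval]
  set I := ∫ t in (0:ℝ)..1, ‖∑ k ∈ Finset.range N, c k * circlePoint t ^ k‖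
  have hU := sum_sq_taylorCoeff_le hu N
  have hV := sum_sq_taylorCoeff_le hv N
  rw [hint fun z hz => by
    rw [huv z (sphere_subset_closedBall hz), norm_mul, ← hnorm z hz, sq]] at hU
  rw [hint fun z hz => by
    rw [huv z (sphere_subset_closedBall hz), norm_mul, hnorm z hz, sq]] at hV
  have hsum : ∑ k ∈ Finset.range N, ‖c k‖ ^ 2 / 2 ^ k = ∑ k ∈ Finset.range N,
      ‖∑ i ∈ Finset.range (k + 1), iteratedDeriv i u 0 / i.factorial *
        (iteratedDeriv (k - i) v 0 / (k - i).factorial)‖ ^ 2 / 2 ^ k :=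
    Finset.sum_congr rfl fun k hk => by rw [← hck k hk]
  have hC := sum_sq_cauchyProduct_le (fun i => iteratedDeriv i u 0 / i.factorial)
    (fun i => iteratedDeriv i v 0 / i.factorial) N
  rw [hsum, sq]
  refine hC.trans (mul_le_mul hU hV (Finset.sum_nonneg fun _ _ => by positivity)
    (le_trans (Finset.sum_nonneg fun _ _ => by positivity) hU))

/-! ### Hypercontractivity in several Steinhaus variables. -/

lemma steinhausLaw_eq_map : steinhausLaw =
    (volume.restrict (Set.Ioc (0 : ℝ) 1)).map circlePoint := rfl

instance : IsProbabilityMeasure steinhausLaw := by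
  have : IsProbabilityMeasure (volume.restrict (Set.Ioc (0 : ℝ) 1)) := ⟨by simp⟩
  rw [steinhausLaw_eq_map]
  exact Measure.isProbabilityMeasure_map continuous_circlePoint.aemeasurable

lemma integral_steinhausLaw {f : ℂ → ℝ} (hf : Continuous f) :
    ∫ z, f z ∂steinhausLaw = ∫ t in (0:ℝ)..1, f (circlePoint t) := by
  rw [steinhausLaw_eq_map, integral_map continuous_circlePoint.aemeasurable
    hf.aestronglyMeasurable, intervalIntegral.integral_of_le zero_le_one]

lemma ae_norm_eq_one_steinhausLaw : ∀ᵐ z ∂steinhausLaw, ‖z‖ = 1 := by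
  rw [steinhausLaw_eq_map, ae_map_iff continuous_circlePoint.aemeasurable
    (measurableSet_eq_fun (by fun_prop) (by fun_prop))]
  simp

lemma ae_norm_eq_one_pi_steinhausLaw (ι : Type*) [Fintype ι] :
    ∀ᵐ w ∂(Measure.pi fun _ : ι => steinhausLaw), ∀ i, ‖w i‖ = 1 := by
  rw [ae_all_iff]
  intro i
  exact (Measure.quasiMeasurePreserving_eval (μ := fun _ : ι => steinhausLaw) i).ae
    ae_norm_eq_one_steinhausLaw

lemma integrable_monomial {E : Type*} [NormedAddCommGroup E] [NormedSpace ℂ E]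
    {ι : Type*} [Fintype ι] (β : ι → ℕ) (x : E) :
    Integrable (fun w : ι → ℂ => (∏ i, w i ^ β i) • x)
      (Measure.pi fun _ : ι => steinhausLaw) := by
  refine Integrable.of_bound (Continuous.aestronglyMeasurable (by fun_prop)) ‖x‖ ?_
  filter_upwards [ae_norm_eq_one_pi_steinhausLaw ι] with w hw
  simp [norm_smul, norm_prod, hw]

lemma integrable_polynomial {ι κ : Type*} [Fintype ι] [Fintype κ] (β : κ → ι → ℕ) (c : κ → ℂ) :
    Integrable (fun w : ι → ℂ => ∑ k, c k * ∏ i, w i ^ β k i)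
      (Measure.pi fun _ : ι => steinhausLaw) := by
  refine integrable_finsetSum _ fun k _ => ?_
  simpa [mul_comm] using integrable_monomial (β k) (c k)

/-- **Minkowski's inequality**: the `ℓ₂`-norm of an integral is at most the integral of the
`ℓ₂`-norm. -/
lemma sqrt_sum_sq_integral_le {ι Ω : Type*} [Fintype ι] [MeasurableSpace Ω] {μ : Measure Ω}
    {f : ι → Ω → ℝ} (hf : ∀ i, Integrable (f i) μ) :
    √(∑ i, (∫ ω, f i ω ∂μ) ^ 2) ≤ ∫ ω, √(∑ i, f i ω ^ 2) ∂μ := by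
  -- This is the triangle inequality for the Bochner integral in Euclidean space.
  have h := norm_integral_le_integral_norm (μ := μ)
    (fun ω => WithLp.toLp 2 fun i => f i ω : Ω → EuclideanSpace ℝ ι)
  have hint : ∀ i, Integrable
      (fun ω => (WithLp.toLp 2 fun i => f i ω : EuclideanSpace ℝ ι) i) μ := hf
  simp only [EuclideanSpace.norm_eq, Real.norm_eq_abs, sq_abs] at h
  simpa only [MeasureTheory.eval_integral_piLp hint] using h

lemma sqrt_sum_sq_coeff_one_le {d : ℕ} (c : Fin d → ℂ) :
    √(∑ k, ‖c k‖ ^ 2 / 2 ^ (k : ℕ)) ≤ ∫ z, ‖∑ k, c k * z ^ (k : ℕ)‖ ∂steinhausLaw := by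
  rw [integral_steinhausLaw (by fun_prop)]
  refine Real.sqrt_le_iff.2 ⟨intervalIntegral.integral_nonneg zero_le_one
    fun _ _ => norm_nonneg _, ?_⟩
  have h := sum_sq_coeff_div_two_pow_le (fun k => if hk : k < d then c ⟨k, hk⟩ else 0) d
  simpa [Finset.sum_range] using h

/-- **Hypercontractivity** for polynomials in `n` Steinhaus variables. -/
theorem sqrt_sum_sq_coeff_le {d : ℕ} (n : ℕ) (c : (Fin n → Fin d) → ℂ) :
    √(∑ β, ‖c β‖ ^ 2 / 2 ^ (∑ i, (β i : ℕ))) ≤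
      ∫ w, ‖∑ β, c β * ∏ i, w i ^ (β i : ℕ)‖ ∂(Measure.pi fun _ : Fin n => steinhausLaw) := by
  induction n with
  | zero => simp [Real.sqrt_sq]
  | succ n ih =>
    set μ := Measure.pi fun _ : Fin n => steinhausLaw
    -- `h k` is the coefficient of the k-th power of the first variable, a polynomial in the other n
    -- variables.
    let h : Fin d → (Fin n → ℂ) → ℂ := fun k w =>
      ∑ β : Fin n → Fin d, c (Fin.cons k β) * ∏ i, w i ^ (β i : ℕ)
    have hh : ∀ k, Integrable (h k) μ := fun k =>
      integrable_polynomial (fun (β : Fin n → Fin d) i => (β i : ℕ)) _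
    let G : ℂ × (Fin n → ℂ) → ℝ := fun p => ‖∑ k, h k p.2 * p.1 ^ (k : ℕ)‖
    have hGc : Continuous G := by fun_prop
    have hmp := measurePreserving_piFinSuccAbove (fun _ : Fin (n + 1) => steinhausLaw) 0
    have hpt : ∀ w : Fin (n + 1) → ℂ, ‖∑ β : Fin (n + 1) → Fin d, c β * ∏ i, w i ^ (β i : ℕ)‖
        = G (MeasurableEquiv.piFinSuccAbove (fun _ => ℂ) 0 w) := by
      intro w
      simp only [G, h]
      congr 1
      rw [← (Fin.consEquiv fun _ : Fin (n + 1) => Fin d).sum_comp, Fintype.sum_prod_type]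
      refine Finset.sum_congr rfl fun k _ => ?_
      rw [Finset.sum_mul]
      refine Finset.sum_congr rfl fun β _ => ?_
      simp [Fin.consEquiv, Fin.prod_univ_succ, MeasurableEquiv.piFinSuccAbove,
        Fin.insertNthEquiv, Fin.tail]
      ring
    have hGint : Integrable G (steinhausLaw.prod μ) := by
      rw [← hmp.integrable_comp_emb (MeasurableEquiv.measurableEmbedding _)]
      refine (integrable_polynomial (fun (β : Fin (n + 1) → Fin d) i => (β i : ℕ))
        c).norm.congr (ae_of_all _ fun w => ?_)
      exact hpt w
    have hRHS : ∫ w, ‖∑ β : Fin (n + 1) → Fin d, c β * ∏ i, w i ^ (β i : ℕ)‖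
        ∂(Measure.pi fun _ : Fin (n + 1) => steinhausLaw) = ∫ w, ∫ z, G (z, w) ∂steinhausLaw ∂μ := by
      rw [← integral_prod_symm _ hGint, ← hmp.integral_comp']
      exact integral_congr_ae (ae_of_all _ hpt)
    rw [hRHS]
    have hsum : ∑ β : Fin (n + 1) → Fin d, ‖c β‖ ^ 2 / 2 ^ (∑ i, (β i : ℕ))
        = ∑ k : Fin d, (∑ β : Fin n → Fin d,
          ‖c (Fin.cons k β)‖ ^ 2 / 2 ^ (∑ i, (β i : ℕ))) / 2 ^ (k : ℕ) := by
      rw [← (Fin.consEquiv fun _ : Fin (n + 1) => Fin d).sum_comp, Fintype.sum_prod_type]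
      refine Finset.sum_congr rfl fun k _ => ?_
      rw [Finset.sum_div]
      refine Finset.sum_congr rfl fun β _ => ?_
      simp [Fin.consEquiv, Fin.sum_univ_succ, pow_add]
      field_simp
    rw [hsum]
    -- The induction hypothesis is applied to each `h k`, Minkowski moves the ℓ₂-sum inside the
    -- integral, and the one-variable case is applied for fixed w.
    calc √(∑ k : Fin d, (∑ β : Fin n → Fin d,
          ‖c (Fin.cons k β)‖ ^ 2 / 2 ^ (∑ i, (β i : ℕ))) / 2 ^ (k : ℕ))
        ≤ √(∑ k : Fin d, (∫ w, ‖h k w‖ / √(2 ^ (k : ℕ)) ∂μ) ^ 2) := by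
          refine Real.sqrt_le_sqrt (Finset.sum_le_sum fun k _ => ?_)
          rw [integral_div, div_pow, Real.sq_sqrt (by positivity)]
          gcongr
          exact (Real.sqrt_le_left (integral_nonneg fun _ => norm_nonneg _)).1
            (ih fun β => c (Fin.cons k β))
      _ ≤ ∫ w, √(∑ k : Fin d, (‖h k w‖ / √(2 ^ (k : ℕ))) ^ 2) ∂μ :=
          sqrt_sum_sq_integral_le fun k => (hh k).norm.div_const _
      _ ≤ ∫ w, ∫ z, G (z, w) ∂steinhausLaw ∂μ := by
          refine integral_mono_of_nonneg (ae_of_all _ fun _ => Real.sqrt_nonneg _)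
            hGint.integral_prod_right (ae_of_all _ fun w => ?_)
          refine le_trans (le_of_eq ?_) (sqrt_sum_sq_coeff_one_le fun k => h k w)
          simp only [div_pow]
          congr 1
          refine Finset.sum_congr rfl fun k _ => ?_
          rw [Real.sq_sqrt (by positivity)]

/-! ### Symmetries of the Gaussian and Rademacher laws. -/

lemma measurePreserving_toComplex :
    MeasurePreserving (fun p : ℝ × ℝ => (p.1 : ℂ) + (p.2 : ℂ) * Complex.I)
      ((gaussianReal 0 (1 / 2)).prod (gaussianReal 0 (1 / 2))) complexGaussianLaw :=
  ⟨by fun_prop, rfl⟩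

instance : IsProbabilityMeasure complexGaussianLaw :=
  Measure.isProbabilityMeasure_map measurePreserving_toComplex.aemeasurable

lemma measurePreserving_neg_gaussianReal (v : ℝ≥0) :
    MeasurePreserving (fun x : ℝ => -x) (gaussianReal 0 v) (gaussianReal 0 v) :=
  ⟨measurable_neg, by rw [gaussianReal_map_neg, neg_zero]⟩

lemma measurePreserving_neg_complexGaussianLaw :
    MeasurePreserving (fun z : ℂ => -z) complexGaussianLaw complexGaussianLaw :=
  measurePreserving_toComplex.of_semiconj
    ((measurePreserving_neg_gaussianReal _).prod (measurePreserving_neg_gaussianReal _))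
    (fun p => by simp; ring) measurable_neg

lemma measurePreserving_conj_complexGaussianLaw :
    MeasurePreserving (starRingEnd ℂ) complexGaussianLaw complexGaussianLaw :=
  measurePreserving_toComplex.of_semiconj
    ((MeasurePreserving.id _).prod (measurePreserving_neg_gaussianReal _))
    (fun p => by simp) Complex.continuous_conj.measurable

lemma measurePreserving_re_complexGaussianLaw :
    MeasurePreserving Complex.re complexGaussianLaw (gaussianReal 0 (1 / 2)) := by
  refine ⟨Complex.measurable_re, ?_⟩
  rw [← measurePreserving_toComplex.map_eq, Measure.map_map Complex.measurable_re
    measurePreserving_toComplex.measurable]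
  convert (measurePreserving_fst (μ := gaussianReal 0 (1 / 2))
    (ν := gaussianReal 0 (1 / 2))).map_eq
  ext p
  simp

/-- The first absolute moment of the real part of a standard complex Gaussian variable. -/
def absMoment : ℝ := ∫ x, |x| ∂gaussianReal 0 (1 / 2)

lemma integrable_abs_gaussianReal : Integrable (fun x : ℝ => |x|) (gaussianReal 0 (1 / 2)) :=
  (memLp_one_iff_integrable.1 (by exact_mod_cast memLp_id_gaussianReal 1)).abs

lemma absMoment_pos : 0 < absMoment := by
  rw [absMoment, integral_pos_iff_support_of_nonneg (fun x => abs_nonneg x)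
    integrable_abs_gaussianReal]
  have hsupp : Function.support (fun x : ℝ => |x|) = {0}ᶜ := by ext; simp
  have hν := nullSingletonClass_gaussianReal (μ := 0) (v := 1 / 2) (by norm_num)
  rw [hsupp, prob_compl_eq_one_sub (measurableSet_singleton 0), measure_singleton]
  simp

section Pi

variable {ι : Type*} [Fintype ι]

lemma measurePreserving_re_eval (i : ι) :
    MeasurePreserving (fun z : ι → ℂ => (z i).re) (Measure.pi fun _ => complexGaussianLaw)
      (gaussianReal 0 (1 / 2)) :=
  measurePreserving_re_complexGaussianLaw.comp
    (measurePreserving_eval (fun _ : ι => complexGaussianLaw) i)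

lemma integrable_abs_re (i : ι) :
    Integrable (fun z : ι → ℂ => |(z i).re|) (Measure.pi fun _ => complexGaussianLaw) :=
  (measurePreserving_re_eval i).integrable_comp_of_integrable integrable_abs_gaussianReal

lemma integral_abs_re (i : ι) :
    ∫ z : ι → ℂ, |(z i).re| ∂(Measure.pi fun _ => complexGaussianLaw) = absMoment := by
  rw [absMoment, ← (measurePreserving_re_eval i).map_eq,
    integral_map (measurePreserving_re_eval i).aemeasurable (by fun_prop)]

/-- A coordinatewise change of sign. -/
lemma measurePreserving_sign_mul {𝕜 : Type*} [Ring 𝕜] [MeasurableSpace 𝕜] {ν : Measure 𝕜}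
    [SigmaFinite ν] (hν : MeasurePreserving (fun z : 𝕜 => -z) ν ν) {s : ι → 𝕜}
    (hs : ∀ i, s i = 1 ∨ s i = -1) :
    MeasurePreserving (fun (z : ι → 𝕜) i => s i * z i) (Measure.pi fun _ => ν)
      (Measure.pi fun _ => ν) := by
  refine measurePreserving_pi (fun _ => ν) (fun _ => ν) (f := fun i z => s i * z) fun i => ?_
  rcases hs i with h | h
  · simp only [h, one_mul]
    exact MeasurePreserving.id ν
  · simpa [h] using hν

end Pi

instance : IsProbabilityMeasure rademacherLaw :=
  ⟨by simp [rademacherLaw, ENNReal.inv_two_add_inv_two]⟩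

lemma measurePreserving_neg_rademacherLaw :
    MeasurePreserving (fun x : ℝ => -x) rademacherLaw rademacherLaw := by
  refine ⟨measurable_neg, ?_⟩
  rw [rademacherLaw, Measure.map_add _ _ measurable_neg, Measure.map_smul, Measure.map_smul,
    Measure.map_dirac' measurable_neg, Measure.map_dirac' measurable_neg, neg_neg, add_comm]

lemma ae_rademacherLaw : ∀ᵐ x ∂rademacherLaw, x = 1 ∨ x = -1 := by
  have hm : MeasurableSet {x : ℝ | x = 1 ∨ x = -1} :=
    (measurableSet_singleton 1).union (measurableSet_singleton (-1))
  rw [rademacherLaw, ae_add_measure_iff]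
  constructor <;> refine Measure.ae_smul_measure ((ae_dirac_iff hm).2 ?_) _ <;> simp

lemma ae_pi_rademacherLaw (ι : Type*) [Fintype ι] :
    ∀ᵐ e ∂(Measure.pi fun _ : ι => rademacherLaw), ∀ i, e i = 1 ∨ e i = -1 := by
  rw [ae_all_iff]
  intro i
  exact (Measure.quasiMeasurePreserving_eval (μ := fun _ : ι => rademacherLaw) i).ae
    ae_rademacherLaw

lemma eLpNorm_two_sq {Ω E : Type*} [MeasurableSpace Ω] [NormedAddCommGroup E] {μ : Measure Ω}
    (f : Ω → E) : eLpNorm f 2 μ ^ 2 = ∫⁻ ω, ‖f ω‖ₑ ^ 2 ∂μ := by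
  have := eLpNorm_nnreal_pow_eq_lintegral (f := f) (μ := μ) (p := 2) (by norm_num)
  simpa using this

/-! ### Rademacher averages against Gaussian averages. -/

section Comparison

variable {X : Type*} [NormedAddCommGroup X] [NormedSpace ℂ X] {ι : Type*} [Fintype ι]

/-- Passing to the real parts does not increase the Gaussian average. -/
lemma lintegral_re_le (x : ι → X) :
    ∫⁻ z : ι → ℂ, ‖∑ i, ((z i).re : ℂ) • x i‖ₑ ^ 2 ∂(Measure.pi fun _ => complexGaussianLaw)
      ≤ eLpNorm (fun z : ι → ℂ => ∑ i, z i • x i) 2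
          (Measure.pi fun _ => complexGaussianLaw) ^ 2 := by
  rw [← eLpNorm_two_sq (fun z : ι → ℂ => ∑ i, ((z i).re : ℂ) • x i)]
  gcongr
  set μ := Measure.pi fun _ : ι => complexGaussianLaw
  set F : (ι → ℂ) → X := fun z => ∑ i, z i • x i with hF
  have hFc : Continuous F := by fun_prop
  have hconj : MeasurePreserving (fun (z : ι → ℂ) i => (starRingEnd ℂ) (z i)) μ μ :=
    measurePreserving_pi _ _ fun _ => measurePreserving_conj_complexGaussianLaw
  -- Taking real parts averages F with its composition with conjugation, which preserves the
  -- Gaussian law.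
  have heq : (fun z : ι → ℂ => ∑ i, ((z i).re : ℂ) • x i)
      = (2⁻¹ : ℂ) • (F + F ∘ fun (z : ι → ℂ) i => (starRingEnd ℂ) (z i)) := by
    ext z
    simp only [hF, Pi.smul_apply, Pi.add_apply, Function.comp, ← Finset.sum_add_distrib,
      Finset.smul_sum, ← add_smul, smul_smul]
    refine Finset.sum_congr rfl fun i _ => ?_
    rw [Complex.re_eq_add_conj]
    congr 1
    ring
  rw [heq, eLpNorm_const_smul]
  calc ‖(2⁻¹ : ℂ)‖ₑ * eLpNorm (F + F ∘ fun (z : ι → ℂ) i => (starRingEnd ℂ) (z i)) 2 μ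
      ≤ ‖(2⁻¹ : ℂ)‖ₑ * (eLpNorm F 2 μ + eLpNorm F 2 μ) := by
        gcongr
        refine (eLpNorm_add_le hFc.aestronglyMeasurable
          (hFc.aestronglyMeasurable.comp_measurePreserving hconj) (by norm_num)).trans ?_
        rw [eLpNorm_comp_measurePreserving hFc.aestronglyMeasurable hconj]
    _ = eLpNorm F 2 μ := by
        rw [← two_mul, ← mul_assoc]
        have : ‖(2⁻¹ : ℂ)‖ₑ = 2⁻¹ := by
          rw [enorm_inv (by norm_num)]
          congr 1
          simp [enorm_eq_nnnorm]
        rw [this, ENNReal.inv_mul_cancel (by norm_num) (by norm_num), one_mul]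

/-- Jensen's inequality: a sign vector is the barycentre of the vectors `(eᵢ |Re zᵢ|)`. -/
lemma absMoment_sq_mul_le [CompleteSpace X] (x : ι → X) (e : ι → ℝ) :
    ENNReal.ofReal absMoment ^ 2 * ‖∑ i, (e i : ℂ) • x i‖ₑ ^ 2
      ≤ ∫⁻ z : ι → ℂ, ‖∑ i, ((e i * |(z i).re| : ℝ) : ℂ) • x i‖ₑ ^ 2
          ∂(Measure.pi fun _ => complexGaussianLaw) := by
  set μ := Measure.pi fun _ : ι => complexGaussianLaw
  set f : (ι → ℂ) → X := fun z => ∑ i, ((e i * |(z i).re| : ℝ) : ℂ) • x i with hf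
  have hfc : Continuous f := by fun_prop
  have h1 : ∫ z, f z ∂μ = (absMoment : ℂ) • ∑ i, (e i : ℂ) • x i := by
    rw [hf, integral_finsetSum]
    · rw [Finset.smul_sum]
      refine Finset.sum_congr rfl fun i _ => ?_
      rw [integral_smul_const, integral_complex_ofReal, integral_const_mul, integral_abs_re,
        smul_smul, mul_comm]
      push_cast; rfl
    · intro i _
      exact (((integrable_abs_re i).const_mul _).ofReal).smul_const _
  have h2 : ‖∫ z, f z ∂μ‖ₑ ≤ eLpNorm f 2 μ := by
    refine (enorm_integral_le_lintegral_enorm f).trans ?_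
    rw [← eLpNorm_one_eq_lintegral_enorm]
    exact eLpNorm_le_eLpNorm_of_exponent_le (by norm_num) hfc.aestronglyMeasurable
  rw [← eLpNorm_two_sq f, ← mul_pow]
  gcongr
  refine le_trans (le_of_eq ?_) h2
  rw [h1, enorm_smul]
  congr 1
  rw [← ofReal_norm, Complex.norm_real, Real.norm_of_nonneg absMoment_pos.le]

/-- Rademacher averages are dominated by complex Gaussian averages. -/
theorem absMoment_sq_mul_lintegral_le [CompleteSpace X] (x : ι → X) :
    ENNReal.ofReal absMoment ^ 2 *
        ∫⁻ e, ‖∑ i, (e i : ℂ) • x i‖ₑ ^ 2 ∂(Measure.pi fun _ : ι => rademacherLaw)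
      ≤ eLpNorm (fun z : ι → ℂ => ∑ i, z i • x i) 2
          (Measure.pi fun _ => complexGaussianLaw) ^ 2 := by
  set μ := Measure.pi fun _ : ι => complexGaussianLaw
  set ρ := Measure.pi fun _ : ι => rademacherLaw
  let Φ : (ι → ℝ) → ℝ≥0∞ := fun t => ‖∑ i, (t i : ℂ) • x i‖ₑ ^ 2
  have hΦ : Continuous Φ := by fun_prop
  have hflip : ∀ t : ι → ℝ, ∫⁻ e, Φ (fun i => e i * |t i|) ∂ρ = ∫⁻ e, Φ (fun i => e i * t i) ∂ρ := by
    intro t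
    -- The signs of the tᵢ can be absorbed into e, whose law is invariant under coordinatewise sign
    -- changes.
    let s : ι → ℝ := fun i => if 0 ≤ t i then 1 else -1
    have hs : ∀ i, s i = 1 ∨ s i = -1 := fun i => by
      by_cases h : 0 ≤ t i <;> simp [s, h]
    have hst : ∀ i, s i * t i = |t i| := fun i => by
      by_cases h : 0 ≤ t i
      · simp [s, h, abs_of_nonneg h]
      · simp [s, h, abs_of_neg (not_le.1 h)]
    have hmp := measurePreserving_sign_mul measurePreserving_neg_rademacherLaw hs
    rw [← hmp.lintegral_comp (f := fun e => Φ fun i => e i * t i) (by fun_prop)]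
    refine lintegral_congr fun e => ?_
    congr 1
    ext i
    rw [← hst]; ring
  calc ENNReal.ofReal absMoment ^ 2 * ∫⁻ e, Φ e ∂ρ
      = ∫⁻ e, ENNReal.ofReal absMoment ^ 2 * Φ e ∂ρ :=
        (lintegral_const_mul _ hΦ.measurable).symm
    _ ≤ ∫⁻ e, ∫⁻ z : ι → ℂ, Φ (fun i => e i * |(z i).re|) ∂μ ∂ρ :=
        lintegral_mono fun e => absMoment_sq_mul_le x e
    _ = ∫⁻ z : ι → ℂ, ∫⁻ e, Φ (fun i => e i * |(z i).re|) ∂ρ ∂μ := by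
        refine lintegral_lintegral_swap (Continuous.measurable ?_).aemeasurable
        unfold Function.uncurry
        fun_prop
    _ = ∫⁻ z : ι → ℂ, ∫⁻ e, Φ (fun i => e i * (z i).re) ∂ρ ∂μ :=
        lintegral_congr fun z => hflip _
    _ = ∫⁻ e, ∫⁻ z : ι → ℂ, Φ (fun i => e i * (z i).re) ∂μ ∂ρ := by
        refine lintegral_lintegral_swap (Continuous.measurable ?_).aemeasurable
        unfold Function.uncurry
        fun_prop
    _ = ∫⁻ _, ∫⁻ z : ι → ℂ, Φ (fun i => (z i).re) ∂μ ∂ρ := by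
        -- Almost every e is a sign vector, and now the symmetric Gaussian law absorbs it.
        refine lintegral_congr_ae ?_
        filter_upwards [ae_pi_rademacherLaw ι] with e he
        have hmp := measurePreserving_sign_mul (ι := ι) measurePreserving_neg_complexGaussianLaw
          (s := fun i => (e i : ℂ)) fun i => by
            rcases he i with h | h <;> simp [h]
        rw [← hmp.lintegral_comp (f := fun z => Φ fun i => (z i).re)
          (Continuous.measurable (by fun_prop))]
        simp
        rfl
    _ = ∫⁻ z : ι → ℂ, Φ (fun i => (z i).re) ∂μ := by simp
    _ ≤ _ := lintegral_re_le x

end Comparison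

/-! ### Bounding the 1-summing norm of the adjoint. -/

section Summing

variable {X : Type*} [NormedAddCommGroup X] [NormedSpace ℂ X]

/-- Evaluation at a/‖a‖ lies in the unit ball of the bidual, hence competes in the supremum defining
`weakOneNorm φ`. -/
lemma sum_norm_apply_le_norm_mul_weakOneNorm {N : ℕ} (φ : Fin N → StrongDual ℂ X) (a : X) :
    ∑ k, ‖φ k a‖ ≤ ‖a‖ * weakOneNorm φ := by
  rcases eq_or_ne a 0 with rfl | ha
  · simp
  let ψ : StrongDual ℂ (StrongDual ℂ X) :=
    NormedSpace.inclusionInDoubleDual ℂ X ((‖a‖ : ℂ)⁻¹ • a)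
  have hψ : ψ ∈ Metric.closedBall (0 : StrongDual ℂ (StrongDual ℂ X)) 1 := by
    refine (mem_closedBall_zero_iff (E := StrongDual ℂ (StrongDual ℂ X))).2 ?_
    refine (NormedSpace.double_dual_bound ℂ X _).trans ?_
    rw [norm_smul, norm_inv, Complex.norm_real, norm_norm,
      inv_mul_cancel₀ (norm_ne_zero_iff.2 ha)]
  have hbdd : BddAbove (Set.range fun ξ : Metric.closedBall
      (0 : StrongDual ℂ (StrongDual ℂ X)) 1 =>
      ∑ k, ‖(ξ : StrongDual ℂ (StrongDual ℂ X)) (φ k)‖) := by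
    refine ⟨∑ k, ‖φ k‖, ?_⟩
    rintro _ ⟨ξ, rfl⟩
    refine Finset.sum_le_sum fun k _ => ?_
    exact ξ.1.le_of_opNorm_le (mem_closedBall_zero_iff.1 ξ.2) _ |>.trans (by rw [one_mul])
  have h := le_ciSup hbdd ⟨ψ, hψ⟩
  have hsum : ∑ k, ‖φ k a‖ = ‖a‖ * ∑ k, ‖ψ (φ k)‖ := by
    rw [Finset.mul_sum]
    refine Finset.sum_congr rfl fun k _ => ?_
    have hψk : ψ (φ k) = (‖a‖ : ℂ)⁻¹ * φ k a := by
      simp only [ψ, NormedSpace.dual_def, map_smul (φ k), smul_eq_mul]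
    rw [hψk, norm_mul, norm_inv, Complex.norm_real, norm_norm,
      mul_inv_cancel_left₀ (norm_ne_zero_iff.2 ha)]
  rw [hsum]
  exact mul_le_mul_of_nonneg_left h (norm_nonneg _)

lemma norm_dualOperator_operatorOf_le {n : ℕ} (x : Fin n → X) (φ : StrongDual ℂ X) :
    ‖dualOperator (operatorOf x) φ‖ ≤ √(∑ i, ‖φ (x i)‖ ^ 2) := by
  refine ContinuousLinearMap.opNorm_le_bound _ (Real.sqrt_nonneg _) fun v => ?_
  have h : dualOperator (operatorOf x) φ v = ∑ i, v i * φ (x i) := by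
    simp [dualOperator, operatorOf]
  rw [h, EuclideanSpace.norm_eq, mul_comm]
  refine (norm_sum_le _ _).trans ?_
  simp only [norm_mul]
  exact Real.sum_mul_le_sqrt_mul_sqrt _ _ _

lemma IsOneSummingWith.oneSummingNorm_le {E F : Type*} [NormedAddCommGroup E] [NormedSpace ℂ E]
    [NormedAddCommGroup F] [NormedSpace ℂ F] {S : E →L[ℂ] F} {C : ℝ≥0}
    (h : IsOneSummingWith S C) : oneSummingNorm S ≤ C :=
  iInf₂_le C h

/-- If a random vector `f` satisfies `(∑ᵢ |φ(xᵢ)|²)^{1/2} ≤ 𝔼|φ(f)|` for all functionals `φ`, then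
the adjoint of `eᵢ ↦ xᵢ` is `1`-summing with constant `𝔼‖f‖`. -/
lemma oneSummingNorm_dualOperator_le {n : ℕ} (x : Fin n → X) {Ω : Type*} [MeasurableSpace Ω]
    {μ : Measure Ω} {f : Ω → X} (hf : Integrable f μ)
    (h : ∀ φ : StrongDual ℂ X, √(∑ i, ‖φ (x i)‖ ^ 2) ≤ ∫ ω, ‖φ (f ω)‖ ∂μ) :
    oneSummingNorm (dualOperator (operatorOf x)) ≤ ENNReal.ofReal (∫ ω, ‖f ω‖ ∂μ) := by
  refine IsOneSummingWith.oneSummingNorm_le fun N φ => ?_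
  rw [Real.coe_toNNReal _ (integral_nonneg fun _ => norm_nonneg _)]
  calc ∑ k, ‖dualOperator (operatorOf x) (φ k)‖
      ≤ ∑ k, ∫ ω, ‖φ k (f ω)‖ ∂μ :=
        Finset.sum_le_sum fun k _ => (norm_dualOperator_operatorOf_le x (φ k)).trans (h _)
    _ = ∫ ω, ∑ k, ‖φ k (f ω)‖ ∂μ :=
        (integral_finsetSum _ fun k _ => ((φ k).integrable_comp hf).norm).symm
    _ ≤ ∫ ω, ‖f ω‖ * weakOneNorm φ ∂μ :=
        integral_mono (integrable_finsetSum _ fun k _ => ((φ k).integrable_comp hf).norm)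
          (hf.norm.mul_const _) fun ω => sum_norm_apply_le_norm_mul_weakOneNorm φ (f ω)
    _ = (∫ ω, ‖f ω‖ ∂μ) * weakOneNorm φ := integral_mul_const _ _

end Summing

/-! ### The dilated polynomial under functionals. -/

section Steinhaus

variable {X : Type*} [NormedAddCommGroup X] [NormedSpace ℂ X] {n m : ℕ}

/-- The polynomial `∑ √2^|α| x_α w^α`. -/
def dilatedPolynomial (x : MultiIndex n m → X) (w : Fin n → ℂ) : X :=
  ∑ α : MultiIndex n m, (((√2 : ℝ) : ℂ) ^ α.degree * ∏ i, w i ^ α.1 i) • x α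

lemma continuous_dilatedPolynomial (x : MultiIndex n m → X) :
    Continuous (dilatedPolynomial x) := by
  unfold dilatedPolynomial
  fun_prop

lemma integrable_dilatedPolynomial (x : MultiIndex n m → X) :
    Integrable (dilatedPolynomial x) (Measure.pi fun _ => steinhausLaw) := by
  refine integrable_finsetSum _ fun α _ => ?_
  simp only [mul_smul]
  exact (integrable_monomial α.1 (x α)).smul (((√2 : ℝ) : ℂ) ^ α.degree)

/-- The multi-indices of total degree at most `m` have all entries at most `m`. -/
def MultiIndex.toFin (α : MultiIndex n m) (i : Fin n) : Fin (m + 1) :=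
  ⟨α.1 i, Nat.lt_succ_of_le ((Finset.single_le_sum (f := α.1) (fun _ _ => Nat.zero_le _)
    (Finset.mem_univ i)).trans α.2)⟩

lemma MultiIndex.toFin_injective : Function.Injective (MultiIndex.toFin (n := n) (m := m)) := by
  intro α β h
  ext i
  exact congrArg Fin.val (congrFun h i)

lemma sqrt_sum_sq_apply_le (x : MultiIndex n m → X) (φ : StrongDual ℂ X) :
    √(∑ α, ‖φ (x α)‖ ^ 2)
      ≤ ∫ w, ‖φ (dilatedPolynomial x w)‖ ∂(Measure.pi fun _ : Fin n => steinhausLaw) := by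
  -- Total degree at most m is embedded in the box of exponents at most m by padding with zero
  -- coefficients. The factor √2^|α| is chosen to cancel the weight 2^{-|α|} after squaring.
  let c : (Fin n → Fin (m + 1)) → ℂ := Function.extend MultiIndex.toFin
    (fun α => ((√2 : ℝ) : ℂ) ^ α.degree * φ (x α)) 0
  have hc : ∀ α, c (MultiIndex.toFin α) = ((√2 : ℝ) : ℂ) ^ α.degree * φ (x α) := fun α =>
    MultiIndex.toFin_injective.extend_apply _ _ α
  have hc0 : ∀ β, β ∉ Set.range (MultiIndex.toFin (n := n) (m := m)) → c β = 0 := fun β hβ =>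
    Function.extend_apply' _ _ _ (by simpa using hβ)
  refine le_trans (le_of_eq ?_) ((sqrt_sum_sq_coeff_le n c).trans (le_of_eq ?_))
  · congr 1
    refine Fintype.sum_of_injective MultiIndex.toFin MultiIndex.toFin_injective _ _
      (fun β hβ => by simp [hc0 β hβ]) fun α => ?_
    have hdeg : ∑ i, (α.toFin i : ℕ) = α.degree := rfl
    rw [hc, hdeg, norm_mul, norm_pow, Complex.norm_real, Real.norm_of_nonneg (Real.sqrt_nonneg _),
      mul_pow, ← pow_mul, mul_comm α.degree, pow_mul, Real.sq_sqrt zero_le_two]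
    field_simp
  · refine integral_congr_ae (ae_of_all _ fun w => ?_)
    simp only [dilatedPolynomial, map_sum, map_smul]
    congr 1
    refine (Fintype.sum_of_injective MultiIndex.toFin MultiIndex.toFin_injective _ _
      (fun β hβ => by simp [hc0 β hβ]) fun α => ?_).symm
    rw [hc, smul_eq_mul]
    simp only [MultiIndex.toFin]
    ring

end Steinhaus

/-! ### Conclusion for arbitrary random variables with the given laws. -/

/-- Rademacher averages in `X` are controlled by the Gaussian averages of the same vectors. -/
lemma sqrt_integral_rademacher_le {X : Type*} [NormedAddCommGroup X] [NormedSpace ℂ X]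
    [CompleteSpace X] {ι Ω : Type*} [Fintype ι] [MeasurableSpace Ω] {P : Measure Ω}
    [IsProbabilityMeasure P] {ε : ι → Ω → ℝ} (hlaw : ∀ i, HasLaw (ε i) rademacherLaw P)
    (hind : iIndepFun ε P) (x : ι → X) {B : ℝ} (hB : 0 ≤ B)
    (h : eLpNorm (fun z : ι → ℂ => ∑ i, z i • x i) 2 (Measure.pi fun _ => complexGaussianLaw)
      ≤ ENNReal.ofReal B) :
    √(∫ ω, ‖∑ i, ε i ω • x i‖ ^ 2 ∂P) ≤ B / absMoment := by
  have hε := iIndepFun.hasLaw_pi hlaw hind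
  have hκ := absMoment_pos
  have hBκ : 0 ≤ B / absMoment := by positivity
  have hlin : ∫⁻ e, ‖∑ i, (e i : ℂ) • x i‖ₑ ^ 2 ∂(Measure.pi fun _ : ι => rademacherLaw)
      ≤ ENNReal.ofReal ((B / absMoment) ^ 2) := by
    have h1 := (absMoment_sq_mul_lintegral_le x).trans (pow_le_pow_left' h 2)
    rw [ENNReal.ofReal_pow hBκ, ENNReal.ofReal_div_of_pos hκ, ENNReal.div_eq_inv_mul, mul_pow,
      ← ENNReal.inv_pow]
    rw [mul_comm] at h1
    rw [mul_comm, ← div_eq_mul_inv]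
    refine (ENNReal.le_div_iff_mul_le ?_ ?_).2 h1
    · left; simpa using hκ
    · left; exact ENNReal.pow_ne_top ENNReal.ofReal_ne_top
  have hint : ∫ ω, ‖∑ i, ε i ω • x i‖ ^ 2 ∂P
      = ∫ e : ι → ℝ, ‖∑ i, (e i : ℂ) • x i‖ ^ 2 ∂(Measure.pi fun _ => rademacherLaw) := by
    rw [← hε.integral_comp (f := fun e : ι → ℝ => ‖∑ i, (e i : ℂ) • x i‖ ^ 2)
      (Continuous.aestronglyMeasurable (by fun_prop))]
    simp
  rw [hint]
  refine Real.sqrt_le_iff.2 ⟨hBκ, ?_⟩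
  rw [integral_eq_lintegral_of_nonneg_ae (ae_of_all _ fun _ => by positivity)
    (Continuous.aestronglyMeasurable (by fun_prop))]
  refine ENNReal.toReal_le_of_le_ofReal (by positivity) ?_
  simpa only [ENNReal.ofReal_pow (norm_nonneg _), ofReal_norm] using hlin

end GaussianAverage

end

theorem theorem3p5 {X : Type*} [NormedAddCommGroup X] [NormedSpace ℂ X] [CompleteSpace X]
    (hX : GaussianAverage.HasGAP X) :
    ∃ C : ℝ, 1 ≤ C ∧
      ∀ (n m : ℕ) (x : GaussianAverage.MultiIndex n m → X)
        {Ω : Type*} [MeasurableSpace Ω] (P : Measure Ω) [IsProbabilityMeasure P]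
        (ε : GaussianAverage.MultiIndex n m → Ω → ℝ)
        (_ : ∀ α, HasLaw (ε α) GaussianAverage.rademacherLaw P) (_ : iIndepFun ε P)
        {Ω' : Type*} [MeasurableSpace Ω'] (Q : Measure Ω') [IsProbabilityMeasure Q]
        (w : Fin n → Ω' → ℂ)
        (_ : ∀ i, HasLaw (w i) GaussianAverage.steinhausLaw Q) (_ : iIndepFun w Q),
        √(∫ ω, ‖∑ α, ε α ω • x α‖ ^ 2 ∂P) ≤
          C * ∫ ω, ‖∑ α : GaussianAverage.MultiIndex n m,
            (((√2 : ℝ) : ℂ) ^ α.degree * ∏ i, w i ω ^ α.1 i) • x α‖ ∂Q := by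
  obtain ⟨C, -, hC⟩ := hX
  -- GAP contributes `C` and the Gaussian comparison 1/𝔼|Re γ|; the maximum secures 1 ≤ C without
  -- evaluating the moment.
  refine ⟨max 1 (C / GaussianAverage.absMoment), le_max_left _ _, ?_⟩
  intro n m x Ω _ P _ ε hε hεi Ω' _ Q _ w hw hwi
  have hpoly : ∫ ω, ‖∑ α : GaussianAverage.MultiIndex n m,
      (((√2 : ℝ) : ℂ) ^ α.degree * ∏ i, w i ω ^ α.1 i) • x α‖ ∂Q
      = ∫ z, ‖GaussianAverage.dilatedPolynomial x z‖
          ∂(Measure.pi fun _ => GaussianAverage.steinhausLaw) :=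
    (iIndepFun.hasLaw_pi hw hwi).integral_comp
      (f := fun z => ‖GaussianAverage.dilatedPolynomial x z‖)
      (GaussianAverage.continuous_dilatedPolynomial x).norm.aestronglyMeasurable
  rw [hpoly]
  set J := ∫ z, ‖GaussianAverage.dilatedPolynomial x z‖
    ∂(Measure.pi fun _ => GaussianAverage.steinhausLaw)
  have hJ : 0 ≤ J := integral_nonneg fun _ => norm_nonneg _
  -- GAP speaks of families indexed by `Fin`, so the multi-indices are enumerated.
  let e := (Fintype.equivFin (GaussianAverage.MultiIndex n m)).symm
  have hsumming := GaussianAverage.oneSummingNorm_dualOperator_le (x ∘ e)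
    (GaussianAverage.integrable_dilatedPolynomial x) fun φ => by
      have := GaussianAverage.sqrt_sum_sq_apply_le x φ
      rwa [← e.sum_comp] at this
  have hgauss := (hC _ (x ∘ e)).trans (mul_le_mul_right hsumming (C : ℝ≥0∞))
  rw [← ENNReal.ofReal_coe_nnreal, ← ENNReal.ofReal_mul C.coe_nonneg] at hgauss
  have h := GaussianAverage.sqrt_integral_rademacher_le (fun i => hε (e i))
    (hεi.precomp e.injective) (x ∘ e) (mul_nonneg C.coe_nonneg hJ) hgauss
  have hsum : ∀ ω, ∑ i, ε (e i) ω • (x ∘ e) i = ∑ α, ε α ω • x α := fun ω =>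
    e.sum_comp fun α => ε α ω • x α
  simp only [hsum] at h
  refine h.trans ?_
  rw [mul_div_right_comm]
  exact mul_le_mul_of_nonneg_right (le_max_right _ _) hJ
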